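/- Let $\mu_X,\mu_Y\in\mathbb{R}$, $\sigma_X,\sigma_Y>0$, $\rho\in(-1,1)$ and let $n\ge 1$ be an integer. Let $Z_1,\ldots,Z_n$ be independent random variables, each distributed as the product $XY$, where $(X,Y)$ is a bivariate normal random vector with mean vector $(\mu_X,\mu_Y)$, variances $(\sigma_X^2,\sigma_Y^2)$ and correlation coefficient $\rho$, and let $\overline{Z}_n=n^{-1}\sum_{i=1}^n Z_i$. Write $r_X=\mu_X/\sigma_X$, $r_Y=\mu_Y/\sigma_Y$, $s_n=\sigma_X\sigma_Y/n$, and suppose that $r_X=r_Y$. For $f\in C^3(\mathbb{R})$ define \begin{align*} A_2f(x)&=s_n^3(1-\rho^2)(1+\rho)\,x f^{(3)}(x)+s_n^2(1+\rho)\big(ns_n(1-\rho^2)+(3\rho-1)x\big)f''(x)\\ &\quad+s_n\big(ns_n(2\rho^2+\rho-1-(1-\rho)r_Xr_Y)-(3\rho+1)x\big)f'(x)+\big(x-ns_n\rho-\mu_X\mu_Y\big)f(x). \end{align*} Let $W$ be a real-valued random variable with $\mathbb{E}|W|<\infty$. Then $W$ has the same distribution as $\overline{Z}_n$ if and only if,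 for all $f:\mathbb{R}\to\mathbb{R}$ in $C^3(\mathbb{R})$ such that $\mathbb{E}|f^{(m)}(\overline{Z}_n)|<\infty$ for $m=0,1,2$ and $\mathbb{E}|\overline{Z}_nf^{(m)}(\overline{Z}_n)|<\infty$ for $m=0,1,2,3$, the expectation $\mathbb{E}[A_2f(W)]$ exists (that is, $\mathbb{E}|A_2f(W)|<\infty$) and $$\mathbb{E}[A_2f(W)]=0.$$ -/

import Mathlib

open MeasureTheory ProbabilityTheory

/-- The bivariate normal law with mean vector `(μX, μY)`, standard deviations `σX, σY` and
correlation coefficient `ρ`, i.e. the Gaussian law on `ℝ²` with covariance matrix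
`[[σX², ρ σX σY], [ρ σX σY, σY²]]` (positive semidefinite when `|ρ| ≤ 1`). -/
noncomputable def bivariateNormal (μX μY σX σY ρ : ℝ) : Measure (EuclideanSpace ℝ (Fin 2)) :=
  multivariateGaussian !₂[μX, μY] !![σX ^ 2, ρ * σX * σY; ρ * σX * σY, σY ^ 2]

/-- `PN(μX, μY; σX², σY²; ρ)`: the law of the product `X Y` for `(X, Y)` bivariate normal. -/
noncomputable def productNormal (μX μY σX σY ρ : ℝ) : Measure ℝ :=
  (bivariateNormal μX μY σX σY ρ).map (fun p => p 0 * p 1)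

/-- The sample mean `n⁻¹ ∑ Zᵢ` of `n` random variables. -/
noncomputable def sampleMean {Ω : Type*} {n : ℕ} (Z : Fin n → Ω → ℝ) (ω : Ω) : ℝ :=
  (n : ℝ)⁻¹ * ∑ i, Z i ω

/-- The third order Stein operator, with `s = σX σY / n` and `rX = μX / σX`, `rY = μY / σY`. -/
noncomputable def steinOp (μX μY σX σY ρ : ℝ) (n : ℕ) (f : ℝ → ℝ) (x : ℝ) : ℝ :=
  let s : ℝ := σX * σY / n
  let rX : ℝ := μX / σX
  let rY : ℝ := μY / σY
  s ^ 3 * (1 - ρ ^ 2) * (1 + ρ) * x * iteratedDeriv 3 f x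
    + s ^ 2 * (1 + ρ) * (n * s * (1 - ρ ^ 2) + (3 * ρ - 1) * x) * iteratedDeriv 2 f x
    + s * (n * s * (2 * ρ ^ 2 + ρ - 1 - (1 - ρ) * rX * rY) - (3 * ρ + 1) * x)
        * iteratedDeriv 1 f x
    + (x - n * s * ρ - μX * μY) * f x

/-- The class of test functions attached to a real random variable `V`: the `f ∈ C³(ℝ)` such that
`E|f⁽ᵐ⁾(V)| < ∞` for `m = 0, 1, 2` and `E|V f⁽ᵐ⁾(V)| < ∞` for `m = 0, 1, 2, 3`. -/
structure IsSteinTestFunction {Ω : Type*} [MeasurableSpace Ω] (P : Measure Ω) (V : Ω → ℝ)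
    (f : ℝ → ℝ) : Prop where
  contDiff : ContDiff ℝ 3 f
  integrable_deriv : ∀ m : ℕ, m ≤ 2 → Integrable (fun ω => iteratedDeriv m f (V ω)) P
  integrable_mul_deriv :
    ∀ m : ℕ, m ≤ 3 → Integrable (fun ω => V ω * iteratedDeriv m f (V ω)) P

/-!
The characteristic function of the sample mean is explicit, and both directions are read off from
the first order linear differential equation it satisfies.

Write `X = σX (A + B)` and `Y = σY (A - B)`. Since `rX = rY = r`, the variables `A` and `B` are
independent with laws `N(r, (1 + ρ) / 2)` and `N(0, (1 - ρ) / 2)`, and `X Y = σX σY (A² - B²)`. The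
characteristic function `φ` of the mean is thus the `n`-th power of a product of two Gaussian
integrals. It has no zeros, and its logarithmic derivative is a rational function of `t` whose
common denominator `D` has degree three and no real zero. Clearing denominators in `φ' = l φ` gives
exactly the statement that the expectation of the Stein operator vanishes on all characters
`x ↦ e^{itx}` (`expectedSymbol_eq_zero_iff`).

If the expectations under `W` vanish, then those of the sines and cosines, which are test functions
because the mean is integrable, show that the characteristic function of `W` solves the same
equation; its quotient by `φ` is constant, so the laws agree (`eq_of_deriv_charFun_eq_mul`).

Conversely, let the expectations of the operator vanish on characters. For `f` of class `C³` with
compact support, the expectation of the operator on the translates of `f` is a continuous integrable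
function of the translation whose Fourier transform vanishes, hence it is zero
(`integral_affineDiffOp_eq_zero_of_hasCompactSupport`). A general test function is multiplied by
cutoffs `χ (x / (n + 1))`; the integrability conditions are just what dominated convergence needs
(`integral_affineDiffOp_eq_zero`). Only the coefficient of `f'''` lacks a constant term, which is
why `E|f'''|` need not be finite.
-/

open scoped FourierTransform Topology NNReal

/-! ### Operators with affine coefficients and the Fourier transform -/

/-- The differential operator `f ↦ ∑ₘ≤N (aₘ + bₘ x) f⁽ᵐ⁾`, with affine coefficients. -/
noncomputable def affineDiffOp (N : ℕ) (a b : ℕ → ℝ) (f : ℝ → ℝ) (x : ℝ) : ℝ :=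
  ∑ m ∈ Finset.range (N + 1), (a m + b m * x) * iteratedDeriv m f x

/-- The expectation `∑ₘ≤N (it)ᵐ ∫ (aₘ + bₘ x) e^{itx} dμ` of the operator `affineDiffOp N a b`
applied to the character `x ↦ e^{itx}`. -/
noncomputable def expectedSymbol (N : ℕ) (a b : ℕ → ℝ) (μ : Measure ℝ) (t : ℝ) : ℂ :=
  ∑ m ∈ Finset.range (N + 1), (t * Complex.I) ^ m *
    ∫ x, (a m + b m * x : ℂ) * Complex.exp (t * x * Complex.I) ∂μ

/-- The convolution theorem for the density `c` against `μ` and an integrable function `G`. -/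
theorem fourier_integral_mul_comp_sub {μ : Measure ℝ} [SFinite μ] {c G : ℝ → ℂ}
    (hc : Integrable c μ) (hG : Integrable G) (t : ℝ) :
    𝓕 (fun y => ∫ x, c x * G (y - x) ∂μ) t =
      (∫ x, c x * Complex.exp ((-2 * Real.pi * t : ℝ) * x * Complex.I) ∂μ) * 𝓕 G t := by
  have hint := hc.convolution_integrand (ContinuousLinearMap.mul ℝ ℂ) hG
  have hint2 : Integrable (Function.uncurry fun y x : ℝ =>
      Complex.exp (((-2 * Real.pi * y * t : ℝ) : ℂ) * Complex.I) * (c x * G (y - x)))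
      (volume.prod μ) := by
    refine hint.bdd_mul (c := 1) (Continuous.aestronglyMeasurable (by fun_prop)) ?_
    exact Filter.Eventually.of_forall fun p => (Complex.norm_exp_ofReal_mul_I _).le
  rw [Real.fourier_real_eq_integral_exp_smul]
  simp_rw [smul_eq_mul, ← integral_const_mul]
  rw [integral_integral_swap hint2, ← integral_mul_const]
  congr 1 with x
  rw [Real.fourier_real_eq_integral_exp_smul,
    ← integral_add_right_eq_self (μ := volume) _ x, ← integral_const_mul]
  congr 1 with y
  simp only [add_sub_cancel_right, smul_eq_mul]
  have : Complex.exp (((-2 * Real.pi * (y + x) * t : ℝ) : ℂ) * Complex.I) =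
      Complex.exp ((-2 * Real.pi * t : ℝ) * x * Complex.I) *
        Complex.exp (((-2 * Real.pi * y * t : ℝ) : ℂ) * Complex.I) := by
    rw [← Complex.exp_add]; push_cast; ring_nf
  rw [this]; ring

theorem iteratedDeriv_ofReal_comp {f : ℝ → ℝ} {N : ℕ} (hf : ContDiff ℝ N f) :
    ∀ m ≤ N, iteratedDeriv m (fun x => (f x : ℂ)) = fun x => ((iteratedDeriv m f x : ℝ) : ℂ) := by
  intro m
  induction m with
  | zero => intro _; simp
  | succ m ih =>
    intro hm
    rw [iteratedDeriv_succ, ih (by omega)]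
    ext x
    have := (hf.differentiable_iteratedDeriv m (by exact_mod_cast hm)) x
    rw [iteratedDeriv_succ]
    exact this.hasDerivAt.ofReal_comp.deriv

theorem HasCompactSupport.iteratedDeriv {E : Type*} [NormedAddCommGroup E] [NormedSpace ℝ E]
    {f : ℝ → E} (hf : HasCompactSupport f) (m : ℕ) :
    HasCompactSupport (_root_.iteratedDeriv m f) := by
  induction m with
  | zero => simpa
  | succ m ih => rw [iteratedDeriv_succ]; exact ih.deriv

/-- Vanishing of the expected symbol kills the operator on compactly supported functions. The
function `h y = ∑ₘ ∫ (aₘ + bₘ x) f⁽ᵐ⁾(x - y) dμ` is continuous and integrable, and its Fourier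
transform is the product of that of `f` with the expected symbol, hence zero; so `h 0 = 0`. -/
theorem integral_affineDiffOp_eq_zero_of_hasCompactSupport {N : ℕ} {a b : ℕ → ℝ} {μ : Measure ℝ}
    [IsFiniteMeasure μ] (hμ : Integrable id μ) (hsymb : ∀ t, expectedSymbol N a b μ t = 0)
    {f : ℝ → ℝ} (hf : ContDiff ℝ N f) (hfc : HasCompactSupport f) :
    ∫ x, affineDiffOp N a b f x ∂μ = 0 := by
  -- `F` is the reflection of `f`, so that `h` becomes a sum of convolutions
  set F : ℝ → ℂ := fun x => (f (-x) : ℂ) with hFdef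
  have hF : ContDiff ℝ N F := Complex.ofRealCLM.contDiff.comp (hf.comp contDiff_neg)
  have hFc : HasCompactSupport F := by
    have h1 : HasCompactSupport fun x => f (-x) := hfc.comp_homeomorph (Homeomorph.neg ℝ)
    exact h1.comp_left (g := fun x : ℝ => (x : ℂ)) (by simp)
  have hFm : ∀ m ≤ N, ∀ x, iteratedDeriv m F x = (-1) ^ m * ((iteratedDeriv m f (-x) : ℝ) : ℂ) := by
    intro m hm x
    rw [hFdef, iteratedDeriv_comp_neg m (fun x => (f x : ℂ)), iteratedDeriv_ofReal_comp hf m hm]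
    simp
  have hcont : ∀ m ≤ N, Continuous (iteratedDeriv m F) := fun m hm =>
    hF.continuous_iteratedDeriv m (by exact_mod_cast hm)
  have hsupp := hFc.iteratedDeriv
  have hint : ∀ m ≤ N, Integrable (iteratedDeriv m F) := fun m hm =>
    (hcont m hm).integrable_of_hasCompactSupport (hsupp m)
  set c : ℕ → ℝ → ℂ := fun m x => (-1) ^ m * (a m + b m * x : ℂ) with hcdef
  have hc : ∀ m, Integrable (c m) μ := fun m =>
    ((integrable_const _).add (hμ.ofReal.const_mul _)).const_mul _
  set h : ℕ → ℝ → ℂ := fun m y => ∫ x, c m x * iteratedDeriv m F (y - x) ∂μ with hhdef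
  have hhint : ∀ m ≤ N, Integrable (h m) := fun m hm =>
    ((hc m).convolution_integrand (ContinuousLinearMap.mul ℝ ℂ) (hint m hm)).integral_prod_left
  have hhcont : ∀ m ≤ N, Continuous (h m) := fun m hm =>
    BddAbove.continuous_convolution_right_of_integrable (ContinuousLinearMap.mul ℝ ℂ)
      ((hcont m hm).norm.bddAbove_range_of_hasCompactSupport (hsupp m).norm) (hc m) (hcont m hm)
  set H : ℝ → ℂ := fun y => ∑ m ∈ Finset.range (N + 1), h m y with hHdef
  have hle : ∀ m ∈ Finset.range (N + 1), m ≤ N := fun m hm => by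
    have := Finset.mem_range.1 hm; omega
  have hHcont : Continuous H := continuous_finsetSum _ fun m hm => hhcont m (hle m hm)
  have hHint : Integrable H := integrable_finsetSum _ fun m hm => hhint m (hle m hm)
  have hFH : 𝓕 H = 0 := by
    ext t
    have h1 : 𝓕 H t = ∑ m ∈ Finset.range (N + 1), 𝓕 (h m) t := by
      simp_rw [Real.fourier_real_eq_integral_exp_smul, hHdef, Finset.smul_sum]
      refine integral_finsetSum _ fun m hm => ?_
      exact (hhint m (hle m hm)).bdd_mul (c := 1) (Continuous.aestronglyMeasurable (by fun_prop))
        (Filter.Eventually.of_forall fun p => (Complex.norm_exp_ofReal_mul_I _).le)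
    rw [h1, Pi.zero_apply]
    have h2 : ∀ m ∈ Finset.range (N + 1), 𝓕 (h m) t = 𝓕 F t *
        (((-2 * Real.pi * t : ℝ) * Complex.I) ^ m * ∫ x, (a m + b m * x : ℂ) *
          Complex.exp ((-2 * Real.pi * t : ℝ) * x * Complex.I) ∂μ) := by
      intro m hm
      rw [hhdef, fourier_integral_mul_comp_sub (hc m) (hint m (hle m hm)),
        Real.fourier_iteratedDeriv (N := N) (by exact_mod_cast hF)
          (fun n hn => hint n (by exact_mod_cast hn)) (by exact_mod_cast hle m hm)]
      simp_rw [hcdef, mul_assoc, integral_const_mul]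
      have : ((-2 * Real.pi * t : ℝ) * Complex.I : ℂ) ^ m =
          (-1) ^ m * (2 * Real.pi * Complex.I * t) ^ m := by
        rw [← mul_pow]; push_cast; ring
      simp only [← mul_assoc] at this ⊢
      rw [this, smul_eq_mul]
      ring
    rw [Finset.sum_congr rfl h2, ← Finset.mul_sum]
    have := hsymb (-2 * Real.pi * t)
    rw [expectedSymbol] at this
    rw [this, mul_zero]
  have hH0 : H 0 = 0 := by
    have := hHcont.fourierInv_fourier_eq hHint (by rw [hFH]; exact integrable_zero _ _ _)
    rw [← this, hFH, Real.fourierInv_eq]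
    simp
  have hfinal : H 0 = ((∫ x, affineDiffOp N a b f x ∂μ : ℝ) : ℂ) := by
    rw [← integral_complex_ofReal]
    simp_rw [affineDiffOp, hHdef, hhdef]
    rw [← integral_finsetSum]
    · congr 1 with x
      push_cast
      refine Finset.sum_congr rfl fun m hm => ?_
      rw [hFm m (hle m hm), hcdef]
      have : ((-1 : ℂ) ^ m) * (-1) ^ m = 1 := by rw [← mul_pow]; simp
      simp only [zero_sub, neg_neg]
      linear_combination (a m + b m * x : ℂ) * ((iteratedDeriv m f x : ℝ) : ℂ) * this
    · intro m hm
      obtain ⟨C, hC⟩ := (hcont m (hle m hm)).norm.bddAbove_range_of_hasCompactSupport (hsupp m).norm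
      exact (hc m).mul_bdd (c := C) ((hcont m (hle m hm)).comp (by fun_prop)).aestronglyMeasurable
        (Filter.Eventually.of_forall fun x => hC ⟨_, rfl⟩)
  exact_mod_cast hfinal.symm.trans hH0

/-! ### Truncation of test functions -/

/-- Derivatives of the cutoffs `x ↦ χ (x / (n + 1))` of positive order vanish in the limit, and the
cutoffs themselves tend to `1`, boundedly in both cases. -/
theorem tendsto_integral_mul_iteratedDeriv_cutoff {μ : Measure ℝ} {χ : ℝ → ℝ} {k : ℕ}
    (hχ : ContDiff ℝ k χ) (hχc : HasCompactSupport χ) (hχ0 : χ 0 = 1) {g : ℝ → ℝ}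
    (hg : Integrable g μ) :
    Filter.Tendsto
      (fun n : ℕ => ∫ x, g x * iteratedDeriv k (fun x => χ (1 / ((n : ℝ) + 1) * x)) x ∂μ)
      Filter.atTop (𝓝 (if k = 0 then ∫ x, g x ∂μ else 0)) := by
  have hcont : Continuous (iteratedDeriv k χ) := hχ.continuous_iteratedDeriv k le_rfl
  have hsupp := hχc.iteratedDeriv k
  obtain ⟨C, hC⟩ := hcont.norm.bddAbove_range_of_hasCompactSupport hsupp.norm
  have hC' : ∀ x, ‖iteratedDeriv k χ x‖ ≤ C := fun x => hC ⟨x, rfl⟩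
  have hlim : (if k = 0 then ∫ x, g x ∂μ else 0) = ∫ x, g x * (0 ^ k * iteratedDeriv k χ 0) ∂μ := by
    split_ifs with hk
    · subst hk; simp [hχ0]
    · simp [hk]
  rw [hlim]
  -- each derivative of the cutoff brings out a factor `1 / (n + 1)`
  simp_rw [fun n : ℕ => iteratedDeriv_comp_const_mul hχ (1 / ((n : ℝ) + 1))]
  have hc : Filter.Tendsto (fun n : ℕ => 1 / ((n : ℝ) + 1)) Filter.atTop (𝓝 0) :=
    tendsto_one_div_add_atTop_nhds_zero_nat
  refine tendsto_integral_of_dominated_convergence (fun x => ‖g x‖ * C) (fun n => ?_)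
    (hg.norm.mul_const C) (fun n => ?_) ?_
  · exact hg.aestronglyMeasurable.mul
      (Continuous.aestronglyMeasurable (continuous_const.mul (hcont.comp (by fun_prop))))
  · refine Filter.Eventually.of_forall fun x => ?_
    rw [norm_mul, norm_mul]
    refine mul_le_mul_of_nonneg_left ?_ (norm_nonneg _)
    refine (mul_le_of_le_one_left (norm_nonneg _) ?_).trans (hC' _)
    rw [norm_pow]
    refine pow_le_one₀ (norm_nonneg _) ?_
    rw [Real.norm_of_nonneg (by positivity), div_le_one (by positivity)]
    linarith [n.cast_nonneg (α := ℝ)]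
  · refine Filter.Eventually.of_forall fun x => ?_
    refine ((hc.pow k).mul ((hcont.tendsto 0).comp ?_)).const_mul (g x)
    simpa using hc.mul_const x

/-- Removal of the compact support: the Leibniz rule applied to `f` times a cutoff only produces
products of the functions assumed integrable with bounded ones. -/
theorem integral_affineDiffOp_eq_zero {N : ℕ} {a b : ℕ → ℝ} {μ : Measure ℝ}
    [IsFiniteMeasure μ] (hμ : Integrable id μ) (hsymb : ∀ t, expectedSymbol N a b μ t = 0)
    {f : ℝ → ℝ} (hf : ContDiff ℝ N f)
    (hint : ∀ m ≤ N, ∀ j ≤ m, Integrable (fun x => (a m + b m * x) * iteratedDeriv j f x) μ) :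
    ∫ x, affineDiffOp N a b f x ∂μ = 0 := by
  let χ : ContDiffBump (0 : ℝ) := ⟨1, 2, one_pos, one_lt_two⟩
  have hχ : ∀ k : ℕ, ContDiff ℝ k χ := fun k => χ.contDiff
  have hχ0 : χ 0 = 1 := χ.one_of_mem_closedBall (by simp [χ.rIn_pos.le])
  set u : ℕ → ℝ → ℝ := fun n x => χ (1 / ((n : ℝ) + 1) * x) with hu
  have hu_diff : ∀ n (k : ℕ), ContDiff ℝ k (u n) := fun n k => (hχ k).comp (by fun_prop)
  have hu_supp : ∀ n, HasCompactSupport (u n) := fun n =>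
    χ.hasCompactSupport.comp_homeomorph
      (Homeomorph.mulLeft₀ (1 / ((n : ℝ) + 1)) (by positivity))
  have hle : ∀ {m M : ℕ}, m ∈ Finset.range (M + 1) → m ≤ M := fun hm => by
    have := Finset.mem_range.1 hm; omega
  have hzero : ∀ n, ∑ m ∈ Finset.range (N + 1), ∑ j ∈ Finset.range (m + 1),
      ∫ x, ((m.choose j : ℝ) * ((a m + b m * x) * iteratedDeriv j f x)) *
        iteratedDeriv (m - j) (u n) x ∂μ = 0 := by
    intro n
    rw [← integral_affineDiffOp_eq_zero_of_hasCompactSupport hμ hsymb (hf.mul (hu_diff n N))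
      ((hu_supp n).mul_left)]
    have hterm : ∀ m ∈ Finset.range (N + 1), ∀ j ∈ Finset.range (m + 1),
        Integrable (fun x => ((m.choose j : ℝ) * ((a m + b m * x) * iteratedDeriv j f x)) *
          iteratedDeriv (m - j) (u n) x) μ := by
      intro m hm j hj
      have hcont := (hu_diff n (m - j)).continuous_iteratedDeriv (m - j) le_rfl
      obtain ⟨C, hC⟩ := hcont.norm.bddAbove_range_of_hasCompactSupport
        ((hu_supp n).iteratedDeriv _).norm
      exact ((hint m (hle hm) j (hle hj)).const_mul _).mul_bdd (c := C) hcont.aestronglyMeasurable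
        (Filter.Eventually.of_forall fun x => hC ⟨_, rfl⟩)
    rw [Finset.sum_congr rfl fun m hm => (integral_finsetSum _ (hterm m hm)).symm,
      ← integral_finsetSum _ fun m hm => integrable_finsetSum _ (hterm m hm)]
    congr 1 with x
    refine Finset.sum_congr rfl fun m hm => ?_
    have hmN : (m : WithTop ℕ∞) ≤ N := by exact_mod_cast hle hm
    rw [iteratedDeriv_fun_mul (hf.of_le hmN).contDiffAt (hu_diff n m).contDiffAt, Finset.mul_sum]
    exact Finset.sum_congr rfl fun j _ => by ring
  have hlim : Filter.Tendsto (fun n : ℕ => ∑ m ∈ Finset.range (N + 1), ∑ j ∈ Finset.range (m + 1),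
      ∫ x, ((m.choose j : ℝ) * ((a m + b m * x) * iteratedDeriv j f x)) *
        iteratedDeriv (m - j) (u n) x ∂μ) Filter.atTop
      (𝓝 (∑ m ∈ Finset.range (N + 1), ∑ j ∈ Finset.range (m + 1), if m - j = 0 then
        ∫ x, ((m.choose j : ℝ) * ((a m + b m * x) * iteratedDeriv j f x)) ∂μ else 0)) :=
    tendsto_finsetSum _ fun m hm => tendsto_finsetSum _ fun j hj =>
      tendsto_integral_mul_iteratedDeriv_cutoff (hχ _) χ.hasCompactSupport hχ0
        ((hint m (hle hm) j (hle hj)).const_mul _)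
  simp_rw [hzero] at hlim
  -- only the terms `j = m`, where the cutoff is not differentiated, survive in the limit
  rw [← tendsto_nhds_unique hlim tendsto_const_nhds]
  simp_rw [affineDiffOp]
  rw [integral_finsetSum _ fun m hm => hint m (hle hm) m le_rfl]
  refine Finset.sum_congr rfl fun m _ => ?_
  rw [Finset.sum_range_succ, Finset.sum_eq_zero]
  · simp
  · intro j hj
    rw [if_neg]
    have := Finset.mem_range.1 hj; omega

/-! ### The law of the product and its characteristic function -/

/-- The quadratic form is `(1 + ρ) / 2 (x₀ σX + x₁ σY)² + (1 - ρ) / 2 (x₀ σX - x₁ σY)²`. -/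
theorem posSemidef_bivariateNormal_cov {σX σY ρ : ℝ} (hρ : ρ ∈ Set.Ioo (-1 : ℝ) 1) :
    (!![σX ^ 2, ρ * σX * σY; ρ * σX * σY, σY ^ 2] : Matrix (Fin 2) (Fin 2) ℝ).PosSemidef := by
  refine Matrix.PosSemidef.of_dotProduct_mulVec_nonneg ?_ fun x => ?_
  · ext i j; fin_cases i <;> fin_cases j <;> simp
  · simp only [Matrix.mulVec, dotProduct, Fin.sum_univ_two, Pi.star_apply, star_trivial,
      Matrix.of_apply, Matrix.cons_val_zero, Matrix.cons_val_one]
    have h1 : 0 ≤ (1 + ρ) / 2 * (x 0 * σX + x 1 * σY) ^ 2 :=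
      mul_nonneg (by linarith [hρ.1]) (sq_nonneg _)
    have h2 : 0 ≤ (1 - ρ) / 2 * (x 0 * σX - x 1 * σY) ^ 2 :=
      mul_nonneg (by linarith [hρ.2]) (sq_nonneg _)
    linarith

/-- A bivariate normal vector with equal mean-to-deviation ratios `r` is
`(σX (A + B), σY (A - B))` with `A ~ N(r, (1 + ρ) / 2)` and `B ~ N(0, (1 - ρ) / 2)` independent. -/
theorem bivariateNormal_eq_map_prod {r σX σY ρ : ℝ} (hρ : ρ ∈ Set.Ioo (-1 : ℝ) 1) :
    bivariateNormal (σX * r) (σY * r) σX σY ρ =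
      ((gaussianReal r ((1 + ρ) / 2).toNNReal).prod (gaussianReal 0 ((1 - ρ) / 2).toNNReal)).map
        (fun p => !₂[σX * (p.1 + p.2), σY * (p.1 - p.2)]) := by
  have hmeas : Measurable (fun p : ℝ × ℝ => !₂[σX * (p.1 + p.2), σY * (p.1 - p.2)]) :=
    Continuous.measurable (by fun_prop)
  have : IsProbabilityMeasure (((gaussianReal r ((1 + ρ) / 2).toNNReal).prod
      (gaussianReal 0 ((1 - ρ) / 2).toNNReal)).map
        (fun p => !₂[σX * (p.1 + p.2), σY * (p.1 - p.2)])) :=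
    Measure.isProbabilityMeasure_map hmeas.aemeasurable
  rw [bivariateNormal]
  refine Measure.ext_of_charFun ?_
  ext t
  rw [charFun_multivariateGaussian (posSemidef_bivariateNormal_cov hρ), charFun_apply,
    integral_map hmeas.aemeasurable (Continuous.aestronglyMeasurable (by fun_prop))]
  have hsplit : ∀ p : ℝ × ℝ, Complex.exp
      (inner ℝ (!₂[σX * (p.1 + p.2), σY * (p.1 - p.2)] : EuclideanSpace ℝ (Fin 2)) t * Complex.I) =
      Complex.exp ((t 0 * σX + t 1 * σY : ℝ) * p.1 * Complex.I) *
        Complex.exp ((t 0 * σX - t 1 * σY : ℝ) * p.2 * Complex.I) := by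
    intro p
    rw [← Complex.exp_add, PiLp.inner_apply, Fin.sum_univ_two]
    simp only [Matrix.cons_val_zero, Matrix.cons_val_one,
      RCLike.inner_apply, conj_trivial]
    push_cast
    ring_nf
  simp_rw [hsplit]
  rw [integral_prod_mul (fun x : ℝ => Complex.exp ((t 0 * σX + t 1 * σY : ℝ) * x * Complex.I))
    (fun x : ℝ => Complex.exp ((t 0 * σX - t 1 * σY : ℝ) * x * Complex.I)),
    ← charFun_apply_real, ← charFun_apply_real, charFun_gaussianReal, charFun_gaussianReal,
    ← Complex.exp_add, Real.coe_toNNReal _ (by linarith [hρ.1]),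
    Real.coe_toNNReal _ (by linarith [hρ.2])]
  congr 1
  simp only [Matrix.mulVec, dotProduct, Fin.sum_univ_two, PiLp.inner_apply,
      Matrix.of_apply, Matrix.cons_val_zero, Matrix.cons_val_one, RCLike.inner_apply, conj_trivial]
  push_cast
  ring

/-- The product of the coordinates is a difference of independent weighted squares, as
`(A + B) (A - B) = A² - B²`. -/
theorem productNormal_eq_map_prod {r σX σY ρ : ℝ} (hρ : ρ ∈ Set.Ioo (-1 : ℝ) 1) :
    productNormal (σX * r) (σY * r) σX σY ρ =
      ((gaussianReal r ((1 + ρ) / 2).toNNReal).prod (gaussianReal 0 ((1 - ρ) / 2).toNNReal)).map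
        (fun p => σX * σY * (p.1 ^ 2 - p.2 ^ 2)) := by
  rw [productNormal, bivariateNormal_eq_map_prod hρ, Measure.map_map
    (Continuous.measurable (by fun_prop)) (Continuous.measurable (by fun_prop))]
  congr 1
  ext p
  simp
  ring

theorem integrable_id_productNormal {r σX σY ρ : ℝ} (hρ : ρ ∈ Set.Ioo (-1 : ℝ) 1) :
    Integrable id (productNormal (σX * r) (σY * r) σX σY ρ) := by
  rw [productNormal_eq_map_prod hρ, integrable_map_measure aestronglyMeasurable_id
    (Continuous.aemeasurable (by fun_prop))]
  have h : ∀ (m : ℝ) (v : ℝ≥0), Integrable (fun x => x ^ 2) (gaussianReal m v) := fun m v =>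
    (memLp_id_gaussianReal 2).integrable_sq
  exact (((h _ _).comp_fst _).sub ((h _ _).comp_snd _)).const_mul _

/-- The characteristic function of the square of an `N(m, v)` variable. -/
noncomputable def gaussianSqCharFun (m : ℝ) (v : ℝ≥0) (t : ℝ) : ℂ :=
  ∫ x, Complex.exp (t * (x : ℂ) ^ 2 * Complex.I) ∂(gaussianReal m v)

theorem charFun_productNormal {r σX σY ρ : ℝ} (hρ : ρ ∈ Set.Ioo (-1 : ℝ) 1) (t : ℝ) :
    charFun (productNormal (σX * r) (σY * r) σX σY ρ) t =
      gaussianSqCharFun r ((1 + ρ) / 2).toNNReal (σX * σY * t) *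
        gaussianSqCharFun 0 ((1 - ρ) / 2).toNNReal (-(σX * σY * t)) := by
  rw [productNormal_eq_map_prod hρ, charFun_apply_real, integral_map
    (Continuous.aemeasurable (by fun_prop)) (Continuous.aestronglyMeasurable (by fun_prop)),
    gaussianSqCharFun, gaussianSqCharFun, ← integral_prod_mul]
  congr 1 with p
  rw [← Complex.exp_add]
  push_cast
  ring_nf

theorem one_sub_mul_I_ne_zero (x : ℝ) : (1 - x * Complex.I : ℂ) ≠ 0 := fun h => by
  have := congrArg Complex.re h
  simp at this

/-- The closed form `(1 - 2ivt)^(-1/2) exp (i t m² / (1 - 2ivt))`, with the square root written so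
as to come directly out of the Gaussian integral. -/
theorem gaussianSqCharFun_eq (m : ℝ) {v : ℝ≥0} (hv : v ≠ 0) (t : ℝ) :
    gaussianSqCharFun m v t = ((√(2 * Real.pi * v))⁻¹ : ℝ) *
      ((2 * Real.pi * v : ℝ) / (1 - (2 * v * t : ℝ) * Complex.I)) ^ (1 / 2 : ℂ) *
        Complex.exp (m ^ 2 * (t * Complex.I / (1 - (2 * v * t : ℝ) * Complex.I))) := by
  have hv' : (v : ℂ) ≠ 0 := by exact_mod_cast hv
  have hD := one_sub_mul_I_ne_zero (2 * v * t)
  push_cast at hD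
  rw [gaussianSqCharFun, integral_gaussianReal_eq_integral_smul hv]
  have h1 : ∀ x : ℝ, gaussianPDFReal m v x • Complex.exp (t * (x : ℂ) ^ 2 * Complex.I) =
      ((√(2 * Real.pi * v))⁻¹ : ℝ) * Complex.exp ((t * Complex.I - (2 * v : ℂ)⁻¹) * (x : ℂ) ^ 2 +
        (m / v) * x + -m ^ 2 / (2 * v)) := by
    intro x
    rw [gaussianPDFReal, Complex.real_smul, Complex.ofReal_mul, Complex.ofReal_exp, mul_assoc,
      ← Complex.exp_add]
    congr 2
    push_cast
    field_simp
    ring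
  simp_rw [h1]
  -- the density contributes `-1 / (2v)` to the quadratic coefficient
  have hre : (t * Complex.I - (2 * v : ℂ)⁻¹).re < 0 := by
    have : ((2 * v : ℂ)⁻¹) = (((2 * v : ℝ)⁻¹ : ℝ) : ℂ) := by push_cast; rfl
    rw [this]
    simp only [Complex.sub_re, Complex.mul_re, Complex.ofReal_re, Complex.I_re, Complex.ofReal_im,
      Complex.I_im]
    have : 0 < (2 * (v : ℝ))⁻¹ := by positivity
    linarith
  have hb : (t * Complex.I - (2 * v : ℂ)⁻¹) = -(1 - (2 * v * t) * Complex.I) / (2 * v) := by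
    field_simp
    ring
  rw [integral_const_mul, integral_cexp_quadratic hre, hb, ← mul_assoc]
  congr 2
  · congr 1
    push_cast
    field_simp
  · push_cast
    field_simp
    ring

theorem gaussianSqCharFun_ne_zero (m : ℝ) {v : ℝ≥0} (hv : v ≠ 0) (t : ℝ) :
    gaussianSqCharFun m v t ≠ 0 := by
  have hpos : 0 < 2 * Real.pi * v := by positivity
  rw [gaussianSqCharFun_eq m hv]
  refine mul_ne_zero (mul_ne_zero ?_ ?_) (Complex.exp_ne_zero _)
  · exact_mod_cast (inv_pos.2 (Real.sqrt_pos.2 hpos)).ne'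
  · rw [Ne, Complex.cpow_eq_zero_iff, not_and_or]
    exact Or.inl (div_ne_zero (by exact_mod_cast hpos.ne') (one_sub_mul_I_ne_zero _))

theorem hasDerivAt_gaussianSqCharFun (m : ℝ) {v : ℝ≥0} (hv : v ≠ 0) (t : ℝ) :
    HasDerivAt (gaussianSqCharFun m v)
      ((v * Complex.I / (1 - (2 * v * t : ℝ) * Complex.I) +
        m ^ 2 * Complex.I / (1 - (2 * v * t : ℝ) * Complex.I) ^ 2) * gaussianSqCharFun m v t) t := by
  have hpos : 0 < 2 * Real.pi * v := by positivity
  have hD := one_sub_mul_I_ne_zero (2 * v * t)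
  have hof : HasDerivAt (fun s : ℝ => (s : ℂ)) 1 t := (hasDerivAt_id t).ofReal_comp
  have hDd : HasDerivAt (fun s : ℝ => (1 - (2 * v * s : ℝ) * Complex.I : ℂ))
      (-(2 * v * Complex.I)) t := by
    have := ((hof.const_mul (2 * v : ℂ)).mul_const Complex.I).const_sub 1
    simpa using this
  -- the base of the power has positive real part, so the principal square root is differentiable
  have hslit : ((2 * Real.pi * v : ℝ) / (1 - (2 * v * t : ℝ) * Complex.I) : ℂ) ∈
      Complex.slitPlane := by
    left
    rw [Complex.div_re]
    have : 0 < Complex.normSq (1 - (2 * v * t : ℝ) * Complex.I) := Complex.normSq_pos.2 hD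
    have hre : (1 - (2 * v * t : ℝ) * Complex.I : ℂ).re = 1 := by simp
    rw [hre, Complex.ofReal_re, Complex.ofReal_im]
    simp only [mul_one, zero_mul, zero_div, add_zero]
    positivity
  have hz : HasDerivAt (fun s : ℝ =>
      ((2 * Real.pi * v : ℝ) : ℂ) / (1 - (2 * v * s : ℝ) * Complex.I)) _ t :=
    ((hasDerivAt_const t ((2 * Real.pi * v : ℝ) : ℂ)).div hDd hD)
  have hcpow := ((hasDerivAt_id _).cpow_const (c := (1 / 2 : ℂ)) hslit).comp t hz
  have hexp := (((hof.mul_const Complex.I).div hDd hD).const_mul ((m : ℂ) ^ 2)).cexp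
  have hall := (hcpow.const_mul (((√(2 * Real.pi * v))⁻¹ : ℝ) : ℂ)).mul hexp
  have hfun : gaussianSqCharFun m v = fun t => ((√(2 * Real.pi * v))⁻¹ : ℝ) *
      ((2 * Real.pi * v : ℝ) / (1 - (2 * v * t : ℝ) * Complex.I)) ^ (1 / 2 : ℂ) *
        Complex.exp (m ^ 2 * (t * Complex.I / (1 - (2 * v * t : ℝ) * Complex.I))) :=
    funext fun t => gaussianSqCharFun_eq m hv t
  rw [hfun]
  refine hall.congr_deriv ?_
  have hpi : ((2 * Real.pi * v : ℝ) : ℂ) ≠ 0 := by exact_mod_cast hpos.ne'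
  simp only [Pi.div_apply, Function.comp_apply, id]
  rw [Complex.cpow_sub _ _ (div_ne_zero hpi hD), Complex.cpow_one]
  generalize hE : Complex.exp _ = E
  generalize hP : (_ : ℂ) ^ (1 / 2 : ℂ) = Q
  generalize hp : ((2 * Real.pi * v : ℝ) : ℂ) = p at *
  have hDt : (1 - (2 * v * t : ℝ) * Complex.I : ℂ) = 1 - 2 * v * t * Complex.I := by push_cast; ring
  rw [hDt] at *
  field_simp
  ring

/-! ### Characters as test functions and uniqueness of the law -/

theorem hasDerivAt_charFun_of_integrable {μ : Measure ℝ} [IsFiniteMeasure μ]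
    (hμ : Integrable id μ) (t : ℝ) :
    HasDerivAt (charFun μ) (Complex.I * ∫ x, (x : ℂ) * Complex.exp (t * x * Complex.I) ∂μ) t := by
  have hLp : MemLp id (1 : ℕ) μ := by simpa [memLp_one_iff_integrable] using hμ
  have h1 := iteratedDeriv_charFun (t := t) hLp
  simp only [iteratedDeriv_one, pow_one] at h1
  rw [← h1]
  exact ((contDiff_charFun hLp).differentiable (by simp) t).hasDerivAt

/-- Multiplication by `x` under the integral is `-i d/dt` on the characteristic function. -/
theorem expectedSymbol_eq {N : ℕ} {a b : ℕ → ℝ} {μ : Measure ℝ} [IsFiniteMeasure μ]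
    (hμ : Integrable id μ) (t : ℝ) :
    expectedSymbol N a b μ t =
      (∑ m ∈ Finset.range (N + 1), a m * (t * Complex.I) ^ m) * charFun μ t -
        Complex.I * (∑ m ∈ Finset.range (N + 1), b m * (t * Complex.I) ^ m) *
          deriv (charFun μ) t := by
  have hbd : ∀ x : ℝ, ‖Complex.exp (t * x * Complex.I)‖ ≤ 1 := fun x => by
    rw [← Complex.ofReal_mul]; exact (Complex.norm_exp_ofReal_mul_I _).le
  have hae : AEStronglyMeasurable (fun x : ℝ => Complex.exp (t * x * Complex.I)) μ :=
    Continuous.aestronglyMeasurable (by fun_prop)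
  have h0 : Integrable (fun x : ℝ => Complex.exp (t * x * Complex.I)) μ :=
    (integrable_const (1 : ℝ)).mono' hae (Filter.Eventually.of_forall hbd)
  have h1 : Integrable (fun x : ℝ => (x : ℂ) * Complex.exp (t * x * Complex.I)) μ :=
    hμ.ofReal.mul_bdd (c := 1) hae (Filter.Eventually.of_forall hbd)
  rw [(hasDerivAt_charFun_of_integrable hμ t).deriv, charFun_apply_real, expectedSymbol,
    Finset.sum_mul, Finset.mul_sum, Finset.sum_mul, ← Finset.sum_sub_distrib]
  refine Finset.sum_congr rfl fun m _ => ?_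
  have : ∀ x : ℝ, (a m + b m * x : ℂ) * Complex.exp (t * x * Complex.I) =
      a m * Complex.exp (t * x * Complex.I) + b m * (x * Complex.exp (t * x * Complex.I)) :=
    fun x => by ring
  simp_rw [this]
  rw [integral_add (h0.const_mul _) (h1.const_mul _), integral_const_mul, integral_const_mul]
  linear_combination ((t * Complex.I) ^ m * b m *
    (∫ x, (x : ℂ) * Complex.exp (t * x * Complex.I) ∂μ)) * Complex.I_mul_I

/-- A first order linear differential equation determines a characteristic function without
zeros. -/
theorem eq_of_deriv_charFun_eq_mul {μ ν : Measure ℝ} [IsProbabilityMeasure μ]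
    [IsProbabilityMeasure ν] (hμ : Integrable id μ) (hν : Integrable id ν)
    (hne : ∀ t, charFun ν t ≠ 0) {l : ℝ → ℂ}
    (hμl : ∀ t, deriv (charFun μ) t = l t * charFun μ t)
    (hνl : ∀ t, deriv (charFun ν) t = l t * charFun ν t) : μ = ν := by
  have hd : ∀ t, HasDerivAt (charFun μ / charFun ν) 0 t := by
    intro t
    have h1 := (hasDerivAt_charFun_of_integrable hμ t).differentiableAt.hasDerivAt
    have h2 := (hasDerivAt_charFun_of_integrable hν t).differentiableAt.hasDerivAt
    rw [hμl] at h1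
    rw [hνl] at h2
    exact (h1.div h2 (hne t)).congr_deriv (by ring)
  refine Measure.ext_of_charFun (funext fun t => ?_)
  have := is_const_of_deriv_eq_zero (fun t => (hd t).differentiableAt) (fun t => (hd t).deriv) t 0
  simp only [Pi.div_apply, charFun_zero, probReal_univ, Complex.ofReal_one, div_one] at this
  exact (div_eq_one_iff_eq (hne t)).1 this

theorem iteratedDeriv_re_mul_cexp (z : ℂ) (t : ℝ) (m : ℕ) :
    iteratedDeriv m (fun x : ℝ => (z * Complex.exp (t * x * Complex.I)).re) =
      fun x : ℝ => ((t * Complex.I) ^ m * z * Complex.exp (t * x * Complex.I)).re := by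
  induction m with
  | zero => simp
  | succ m ih =>
    rw [iteratedDeriv_succ, ih]
    ext x
    have hof : HasDerivAt (fun s : ℝ => (s : ℂ)) 1 x := (hasDerivAt_id x).ofReal_comp
    have h := (((hof.const_mul (t : ℂ)).mul_const Complex.I).cexp).const_mul
      ((t * Complex.I) ^ m * z)
    have h2 := (Complex.reCLM.hasFDerivAt.comp_hasDerivAt x h).deriv
    simp only [Complex.reCLM_apply, Function.comp_def] at h2
    rw [h2]
    congr 1
    ring

theorem contDiff_re_mul_cexp (z : ℂ) (t : ℝ) (k : WithTop ℕ∞) :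
    ContDiff ℝ k (fun x : ℝ => (z * Complex.exp (t * x * Complex.I)).re) :=
  Complex.reCLM.contDiff.comp (contDiff_const.mul
    ((contDiff_const.mul Complex.ofRealCLM.contDiff).mul contDiff_const).cexp)

/-- Sines and cosines are test functions: integrability of `V` suffices, as all their derivatives are
bounded. -/
theorem isSteinTestFunction_re_mul_cexp {Ω : Type*} [MeasurableSpace Ω] {P : Measure Ω}
    [IsFiniteMeasure P] {V : Ω → ℝ} (hV : Integrable V P) (z : ℂ) (t : ℝ) :
    IsSteinTestFunction P V (fun x : ℝ => (z * Complex.exp (t * x * Complex.I)).re) := by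
  have hae : ∀ m : ℕ, AEStronglyMeasurable (fun ω => iteratedDeriv m
      (fun x : ℝ => (z * Complex.exp (t * x * Complex.I)).re) (V ω)) P := fun m =>
    ((contDiff_re_mul_cexp z t m).continuous_iteratedDeriv m
      le_rfl).measurable.comp_aemeasurable hV.aemeasurable |>.aestronglyMeasurable
  have hbd : ∀ m : ℕ, ∀ x : ℝ, ‖iteratedDeriv m
      (fun x : ℝ => (z * Complex.exp (t * x * Complex.I)).re) x‖ ≤ ‖(t * Complex.I) ^ m * z‖ := by
    intro m x
    rw [iteratedDeriv_re_mul_cexp]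
    refine (Complex.abs_re_le_norm _).trans ?_
    rw [norm_mul, ← Complex.ofReal_mul, Complex.norm_exp_ofReal_mul_I, mul_one]
  exact ⟨contDiff_re_mul_cexp z t 3,
    fun m _ => (integrable_const ‖(t * Complex.I) ^ m * z‖).mono' (hae m)
      (Filter.Eventually.of_forall fun ω => hbd m _),
    fun m _ => hV.mul_bdd (hae m) (Filter.Eventually.of_forall fun ω => hbd m _)⟩

/-- If the expectation of the operator vanishes on the real parts of all multiples of characters,
the expected symbol vanishes. -/
theorem expectedSymbol_eq_zero_of_integral_eq_zero {N : ℕ} {a b : ℕ → ℝ} {μ : Measure ℝ}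
    [IsFiniteMeasure μ] (hμ : Integrable id μ) (t : ℝ)
    (h : ∀ z : ℂ, ∫ x, affineDiffOp N a b
      (fun x : ℝ => (z * Complex.exp (t * x * Complex.I)).re) x ∂μ = 0) :
    expectedSymbol N a b μ t = 0 := by
  have hbd : ∀ x : ℝ, ‖Complex.exp (t * x * Complex.I)‖ ≤ 1 := fun x => by
    rw [← Complex.ofReal_mul]; exact (Complex.norm_exp_ofReal_mul_I _).le
  have hint : ∀ m, Integrable
      (fun x : ℝ => (a m + b m * x : ℂ) * Complex.exp (t * x * Complex.I)) μ := fun m =>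
    ((integrable_const _).add (hμ.ofReal.const_mul _)).mul_bdd (c := 1)
      (Continuous.aestronglyMeasurable (by fun_prop)) (Filter.Eventually.of_forall hbd)
  have hre : ∀ z : ℂ, (z * expectedSymbol N a b μ t).re = 0 := by
    intro z
    rw [← h z]
    have hsum : z * expectedSymbol N a b μ t = ∫ x, ∑ m ∈ Finset.range (N + 1),
        z * ((t * Complex.I) ^ m * ((a m + b m * x : ℂ) * Complex.exp (t * x * Complex.I))) ∂μ := by
      rw [integral_finsetSum _ fun m _ => ((hint m).const_mul _).const_mul _, expectedSymbol,
        Finset.mul_sum]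
      simp_rw [integral_const_mul]
    rw [hsum]
    have := integral_re (𝕜 := ℂ) (integrable_finsetSum (Finset.range (N + 1)) fun m _ =>
      ((hint m).const_mul ((t * Complex.I : ℂ) ^ m)).const_mul z)
    simp only [RCLike.re_eq_complex_re] at this
    rw [← this]
    congr 1 with x
    rw [affineDiffOp, Complex.re_sum]
    refine Finset.sum_congr rfl fun m _ => ?_
    rw [iteratedDeriv_re_mul_cexp, ← Complex.re_ofReal_mul]
    congr 1
    push_cast
    ring
  -- `z = 1` and `z = -i` give the real and imaginary parts
  have h1 := hre 1
  have h2 := hre (-Complex.I)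
  simp at h1 h2
  exact Complex.ext h1 h2

/-! ### The Stein operator of the sample mean -/

/-- The constant terms of the coefficients of the Stein operator when `rX = rY = r`. -/
def steinConstCoeff (n s r ρ : ℝ) : ℕ → ℝ
  | 0 => -(n * s * (ρ + r ^ 2))
  | 1 => n * s ^ 2 * (2 * ρ ^ 2 + ρ - 1 - (1 - ρ) * r ^ 2)
  | 2 => n * s ^ 3 * (1 + ρ) * (1 - ρ ^ 2)
  | _ => 0

/-- The multipliers of `x` in the coefficients of the Stein operator. -/
def steinLinCoeff (s ρ : ℝ) : ℕ → ℝ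
  | 0 => 1
  | 1 => -(s * (3 * ρ + 1))
  | 2 => s ^ 2 * (1 + ρ) * (3 * ρ - 1)
  | 3 => s ^ 3 * (1 - ρ ^ 2) * (1 + ρ)
  | _ => 0

theorem steinOp_eq_affineDiffOp {r σX σY ρ : ℝ} {n : ℕ} (hσX : σX ≠ 0) (hσY : σY ≠ 0)
    (hn : n ≠ 0) (f : ℝ → ℝ) :
    steinOp (σX * r) (σY * r) σX σY ρ n f =
      affineDiffOp 3 (steinConstCoeff n (σX * σY / n) r ρ) (steinLinCoeff (σX * σY / n) ρ) f := by
  ext x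
  have hn' : (n : ℝ) ≠ 0 := by exact_mod_cast hn
  have hs : (n : ℝ) * (σX * σY / n) = σX * σY := by field_simp
  simp only [steinOp, affineDiffOp, Finset.sum_range_succ, Finset.sum_range_zero, steinConstCoeff,
    steinLinCoeff, iteratedDeriv_zero, mul_div_cancel_left₀ _ hσX, mul_div_cancel_left₀ _ hσY]
  linear_combination (r ^ 2 * f x) * hs

/-- The logarithmic derivative at `t` of the characteristic function of the sample mean, for
`rX = rY = r` and `s = σX σY / n`. -/
noncomputable def meanLogDeriv (n s r ρ t : ℝ) : ℂ :=
  n * s * (((1 + ρ) / 2 : ℝ) * Complex.I / (1 - ((1 + ρ) * (s * t) : ℝ) * Complex.I) +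
    r ^ 2 * Complex.I / (1 - ((1 + ρ) * (s * t) : ℝ) * Complex.I) ^ 2 -
    ((1 - ρ) / 2 : ℝ) * Complex.I / (1 - (-((1 - ρ) * (s * t)) : ℝ) * Complex.I))

theorem sum_steinLinCoeff (s ρ t : ℝ) :
    ∑ m ∈ Finset.range (3 + 1), (steinLinCoeff s ρ m : ℂ) * (t * Complex.I) ^ m =
      (1 - ((1 + ρ) * (s * t) : ℝ) * Complex.I) ^ 2 *
        (1 - (-((1 - ρ) * (s * t)) : ℝ) * Complex.I) := by
  simp only [Finset.sum_range_succ, Finset.sum_range_zero, steinLinCoeff]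
  push_cast
  ring

/-- The two symbols of the Stein operator stand in the ratio prescribed by `meanLogDeriv`. This is
where its coefficients come from: clear denominators in the logarithmic derivative. -/
theorem sum_steinConstCoeff (n s r ρ t : ℝ) :
    ∑ m ∈ Finset.range (3 + 1), (steinConstCoeff n s r ρ m : ℂ) * (t * Complex.I) ^ m =
      Complex.I * (∑ m ∈ Finset.range (3 + 1), (steinLinCoeff s ρ m : ℂ) * (t * Complex.I) ^ m) *
        meanLogDeriv n s r ρ t := by
  rw [sum_steinLinCoeff, meanLogDeriv]
  have h1 := one_sub_mul_I_ne_zero ((1 + ρ) * (s * t))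
  have h2 := one_sub_mul_I_ne_zero (-((1 - ρ) * (s * t)))
  simp only [Finset.sum_range_succ, Finset.sum_range_zero, steinConstCoeff]
  generalize hD1 : (1 - ((1 + ρ) * (s * t) : ℝ) * Complex.I : ℂ) = D1 at *
  generalize hD2 : (1 - (-((1 - ρ) * (s * t)) : ℝ) * Complex.I : ℂ) = D2 at *
  field_simp
  rw [← hD1, ← hD2]
  push_cast
  ring_nf
  simp only [show Complex.I ^ 4 = 1 from Complex.I_pow_four, Complex.I_pow_three, Complex.I_sq]
  ring_nf

/-- The expected symbol vanishes exactly when the characteristic function satisfies the first order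
equation with logarithmic derivative `meanLogDeriv`: its leading coefficient has no real zero. -/
theorem expectedSymbol_eq_zero_iff {n s r ρ t : ℝ} {μ : Measure ℝ} [IsFiniteMeasure μ]
    (hμ : Integrable id μ) :
    expectedSymbol 3 (steinConstCoeff n s r ρ) (steinLinCoeff s ρ) μ t = 0 ↔
      deriv (charFun μ) t = meanLogDeriv n s r ρ t * charFun μ t := by
  have hB : (∑ m ∈ Finset.range (3 + 1), (steinLinCoeff s ρ m : ℂ) * (t * Complex.I) ^ m) ≠ 0 := by
    rw [sum_steinLinCoeff]
    exact mul_ne_zero (pow_ne_zero _ (one_sub_mul_I_ne_zero _)) (one_sub_mul_I_ne_zero _)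
  rw [expectedSymbol_eq hμ, sum_steinConstCoeff, mul_assoc _ (meanLogDeriv n s r ρ t),
    ← mul_sub, mul_eq_zero, or_iff_right (mul_ne_zero Complex.I_ne_zero hB), sub_eq_zero, eq_comm]

theorem charFun_map_sampleMean {Ω' : Type*} [MeasurableSpace Ω'] {P' : Measure Ω'}
    [IsProbabilityMeasure P'] {r σX σY ρ : ℝ}
    (hρ : ρ ∈ Set.Ioo (-1 : ℝ) 1) {n : ℕ} {Z : Fin n → Ω' → ℝ}
    (hZ : ∀ i, HasLaw (Z i) (productNormal (σX * r) (σY * r) σX σY ρ) P')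
    (hind : iIndepFun Z P') :
    charFun (P'.map (sampleMean Z)) = fun t =>
      (gaussianSqCharFun r ((1 + ρ) / 2).toNNReal (σX * σY / n * t) *
        gaussianSqCharFun 0 ((1 - ρ) / 2).toNNReal (-(σX * σY / n * t))) ^ n := by
  ext t
  have hZm : ∀ i, AEMeasurable (Z i) P' := fun i => (hZ i).aemeasurable
  have hV : sampleMean Z = fun ω => (n : ℝ)⁻¹ * (fun ω => ∑ i, Z i ω) ω := rfl
  rw [hV, charFun_map_mul_comp (Finset.aemeasurable_fun_sum _ fun i _ => hZm i),
    hind.charFun_map_fun_sum_eq_prod hZm]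
  simp only [Finset.prod_apply, (hZ _).map_eq, Finset.prod_const, Finset.card_univ,
    Fintype.card_fin, charFun_productNormal hρ]
  ring_nf

theorem hasDerivAt_meanCharFun {r s ρ : ℝ} (hρ : ρ ∈ Set.Ioo (-1 : ℝ) 1) (n : ℕ) (t : ℝ) :
    HasDerivAt (fun t => (gaussianSqCharFun r ((1 + ρ) / 2).toNNReal (s * t) *
        gaussianSqCharFun 0 ((1 - ρ) / 2).toNNReal (-(s * t))) ^ n)
      (meanLogDeriv n s r ρ t * (gaussianSqCharFun r ((1 + ρ) / 2).toNNReal (s * t) *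
        gaussianSqCharFun 0 ((1 - ρ) / 2).toNNReal (-(s * t))) ^ n) t := by
  have hv : 0 < (1 + ρ) / 2 := by linarith [hρ.1]
  have hw : 0 < (1 - ρ) / 2 := by linarith [hρ.2]
  have hs : HasDerivAt (fun t : ℝ => s * t) s t := by
    simpa using (hasDerivAt_id t).const_mul s
  have h1 := (hasDerivAt_gaussianSqCharFun r (Real.toNNReal_pos.2 hv).ne' (s * t)).scomp t hs
  have h2 := (hasDerivAt_gaussianSqCharFun 0 (Real.toNNReal_pos.2 hw).ne' (-(s * t))).scomp t hs.neg
  refine ((h1.mul h2).pow n).congr_deriv ?_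
  simp only [Function.comp_apply, Pi.mul_apply, Complex.real_smul, Real.coe_toNNReal _ hv.le,
    Real.coe_toNNReal _ hw.le]
  rw [meanLogDeriv]
  have e1 : 2 * ((1 + ρ) / 2) * (s * t) = (1 + ρ) * (s * t) := by ring
  have e2 : 2 * ((1 - ρ) / 2) * -(s * t) = -((1 - ρ) * (s * t)) := by ring
  simp only [Function.comp_def, Pi.neg_apply, e1, e2, Real.toNNReal_of_nonneg hv.le] at *
  rcases n with _ | n
  · simp
  · simp only [Nat.add_sub_cancel, pow_succ]
    push_cast
    ring

theorem integrable_sampleMean {Ω' : Type*} [MeasurableSpace Ω'] {P' : Measure Ω'}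
    [IsProbabilityMeasure P'] {r σX σY ρ : ℝ}
    (hρ : ρ ∈ Set.Ioo (-1 : ℝ) 1) {n : ℕ} {Z : Fin n → Ω' → ℝ}
    (hZ : ∀ i, HasLaw (Z i) (productNormal (σX * r) (σY * r) σX σY ρ) P') :
    Integrable (sampleMean Z) P' := by
  refine (integrable_finsetSum _ fun i _ => ?_).const_mul _
  have h := integrable_id_productNormal (r := r) (σX := σX) (σY := σY) hρ
  rw [← (hZ i).map_eq] at h
  exact h.comp_aemeasurable (hZ i).aemeasurable

/-- The products that the Leibniz rule produces are integrable. For `m = 3` the constant term of the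
coefficient vanishes, so that integrability of the third derivative itself is not needed. -/
theorem IsSteinTestFunction.integrable_coeff_mul {Ω' : Type*} [MeasurableSpace Ω'] {P' : Measure Ω'}
    {V : Ω' → ℝ} {f : ℝ → ℝ}
    (hf : IsSteinTestFunction P' V f) (hV : AEMeasurable V P') (n s r ρ : ℝ) :
    ∀ m ≤ 3, ∀ j ≤ m, Integrable (fun x => (steinConstCoeff n s r ρ m + steinLinCoeff s ρ m * x) *
      iteratedDeriv j f x) (P'.map V) := by
  intro m hm j hj
  have hcont := hf.contDiff.continuous_iteratedDeriv j (by exact_mod_cast hj.trans hm)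
  rw [integrable_map_measure (Continuous.aestronglyMeasurable (by fun_prop)) hV]
  have hlin := (hf.integrable_mul_deriv j (hj.trans hm)).const_mul (steinLinCoeff s ρ m)
  simp only [Function.comp_def, add_mul, mul_assoc]
  rcases hm.lt_or_eq with hm' | rfl
  · exact ((hf.integrable_deriv j (by omega)).const_mul _).add hlin
  · simpa [steinConstCoeff] using hlin

theorem continuous_affineDiffOp {N : ℕ} (a b : ℕ → ℝ) {f : ℝ → ℝ} (hf : ContDiff ℝ N f) :
    Continuous (affineDiffOp N a b f) := by
  refine continuous_finsetSum _ fun m hm => ?_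
  have := hf.continuous_iteratedDeriv m (by
    have := Finset.mem_range.1 hm
    exact_mod_cast (by omega : m ≤ N))
  fun_prop

theorem theorem2p2
    (μX μY σX σY ρ : ℝ) (hσX : 0 < σX) (hσY : 0 < σY) (hρ : ρ ∈ Set.Ioo (-1 : ℝ) 1)
    (hr : μX / σX = μY / σY)
    (n : ℕ) (hn : 1 ≤ n)
    {Ω' : Type*} [MeasurableSpace Ω'] (P' : Measure Ω') [IsProbabilityMeasure P']
    (Z : Fin n → Ω' → ℝ) (hZ : ∀ i, HasLaw (Z i) (productNormal μX μY σX σY ρ) P')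
    (hind : iIndepFun Z P')
    {Ω : Type*} [MeasurableSpace Ω] (P : Measure Ω) [IsProbabilityMeasure P]
    (W : Ω → ℝ) (hW : Integrable W P) :
    IdentDistrib W (sampleMean Z) P P' ↔
      ∀ f : ℝ → ℝ, IsSteinTestFunction P' (sampleMean Z) f →
        Integrable (fun ω => steinOp μX μY σX σY ρ n f (W ω)) P ∧
          ∫ ω, steinOp μX μY σX σY ρ n f (W ω) ∂P = 0 := by
  obtain ⟨r, rfl, rfl⟩ : ∃ r, μX = σX * r ∧ μY = σY * r :=
    ⟨μX / σX, by field_simp, by rw [hr]; field_simp⟩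
  have hop := steinOp_eq_affineDiffOp (r := r) (ρ := ρ) hσX.ne' hσY.ne' (by omega : n ≠ 0)
  simp only [hop]
  set s := σX * σY / n with hs
  have hV : Integrable (sampleMean Z) P' := integrable_sampleMean hρ hZ
  have hVm := hV.aemeasurable
  have := Measure.isProbabilityMeasure_map hVm
  have := Measure.isProbabilityMeasure_map hW.aemeasurable
  have hν : Integrable id (P'.map (sampleMean Z)) :=
    (integrable_map_measure aestronglyMeasurable_id hVm).2 hV
  have hμ : Integrable id (P.map W) :=
    (integrable_map_measure aestronglyMeasurable_id hW.aemeasurable).2 hW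
  have hφ := charFun_map_sampleMean hρ hZ hind
  have hφ' : ∀ t, deriv (charFun (P'.map (sampleMean Z))) t =
      meanLogDeriv n s r ρ t * charFun (P'.map (sampleMean Z)) t := by
    intro t
    rw [hφ]
    exact (hasDerivAt_meanCharFun hρ n t).deriv
  constructor
  · intro hident f hf
    have hcont := continuous_affineDiffOp (steinConstCoeff n s r ρ) (steinLinCoeff s ρ)
      (by exact_mod_cast hf.contDiff : ContDiff ℝ (3 : ℕ) f)
    have hcoeff := hf.integrable_coeff_mul hVm n s r ρ
    have hint : Integrable (affineDiffOp 3 (steinConstCoeff n s r ρ) (steinLinCoeff s ρ) f)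
        (P.map W) := by
      rw [hident.map_eq]
      exact integrable_finsetSum _ fun m hm =>
        hcoeff m (by have := Finset.mem_range.1 hm; omega) m le_rfl
    refine ⟨hint.comp_aemeasurable hW.aemeasurable, ?_⟩
    rw [← integral_map hW.aemeasurable hcont.aestronglyMeasurable, hident.map_eq]
    exact integral_affineDiffOp_eq_zero hν
      (fun t => (expectedSymbol_eq_zero_iff hν).2 (hφ' t)) (by exact_mod_cast hf.contDiff) hcoeff
  · intro h
    refine ⟨hW.aemeasurable, hVm, eq_of_deriv_charFun_eq_mul hμ hν (fun t => ?_)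
      (fun t => (expectedSymbol_eq_zero_iff hμ).1 ?_) hφ'⟩
    · rw [hφ]
      refine pow_ne_zero _ (mul_ne_zero ?_ ?_)
      · exact gaussianSqCharFun_ne_zero _ (Real.toNNReal_pos.2 (by linarith [hρ.1])).ne' _
      · exact gaussianSqCharFun_ne_zero _ (Real.toNNReal_pos.2 (by linarith [hρ.2])).ne' _
    · refine expectedSymbol_eq_zero_of_integral_eq_zero hμ t fun z => ?_
      rw [integral_map hW.aemeasurable (continuous_affineDiffOp _ _
        (contDiff_re_mul_cexp z t _)).aestronglyMeasurable]
      exact (h _ (isSteinTestFunction_re_mul_cexp hV z t)).2
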